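/- All graphs are finite, simple and undirected. A connected dominating set of a graph $G=(V,E)$ is a set $S\subseteq V$ whose closed neighbourhood is $V$ and that induces a connected (non-empty) subgraph; it is minimal if no proper subset of it is a connected dominating set. A graph is $3$-degenerate if each of its non-empty subgraphs has a vertex of degree at most $3$. For each $n$, let $f(n)$ be the maximum number of minimal connected dominating sets in a $3$-degenerate bipartite planar graph of order $n$. Then $f(n)\in\Omega(1.472^n)$, that is, there are $c>0$ and $n_0$ such that $f(n)\ge c\cdot 1.472^n$ for all $n\ge n_0$. Moreover, this is realised by the following graphs. Let $G_3$ be the graph on the seven vertices $x_1,x_2,x_3,y_1,y_2,y_3,z$ in which $X=\{x_1,x_2,x_3\}$ is a clique, $\{y_1,y_2,y_3\}$ is independent, $x_i$ is adjacent to $y_j$ if and only if $i\ne j$, and $z$ is adjacent exactly to $y_1,y_2,y_3$. Let $G_3^k$ consist of $k$ disjoint copies of $G_3$ and one further vertex $s$ that is adjacent exactly to the vertices of the set $X$ of every copy. Let $H_k$ be the graph obtained from $G_3^k$ by removing, in every copy, the three edges between vertices of $X$. For every $k\ge 1$, the graph $H_k$ has order $n=7k+1$ and is bipartite, $3$-degenerate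 and planar; and for every $k\ge 2$ it has exactly $15^k=15^{(n-1)/7}$ minimal connected dominating sets. -/

import Mathlib

open scoped Asymptotics

namespace MinCDS

/-- `S` is a connected dominating set of `G`: the closed neighbourhood of `S` is the whole vertex
set, and `S` induces a connected (in particular non-empty) subgraph. -/
def IsConnectedDominatingSet {V : Type*} (G : SimpleGraph V) (S : Set V) : Prop :=
  (∀ v : V, v ∈ S ∨ ∃ u ∈ S, G.Adj u v) ∧ (G.induce S).Connected

/-- The number of inclusion-minimal connected dominating sets of `G` (for finite `V`). -/
noncomputable def numMinimalCDS {V : Type*} (G : SimpleGraph V) : ℕ :=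
  {S : Set V | Minimal (IsConnectedDominatingSet G) S}.ncard

/-- `G` is `d`-degenerate: every non-empty (induced) finite subgraph has a vertex of degree at most
`d`. -/
def IsDegenerate {V : Type*} (G : SimpleGraph V) (d : ℕ) : Prop :=
  ∀ W : Finset V, W.Nonempty → ∃ v ∈ W, {w : V | w ∈ W ∧ G.Adj v w}.ncard ≤ d

/-- `A` is a simple arc in the plane with end points `p` and `q`. -/
def IsSimpleArc (p q : ℝ × ℝ) (A : Set (ℝ × ℝ)) : Prop :=
  ∃ γ : unitInterval → ℝ × ℝ, Continuous γ ∧ Function.Injective γ ∧ γ 0 = p ∧ γ 1 = q ∧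
    Set.range γ = A

/-- A plane drawing of `G`: vertices are distinct points, every edge is a simple arc joining its
two ends, an edge passes through no vertex but its ends, and two different edges meet only in
common ends. The value of `arc` at pairs that are not edges of `G` is irrelevant. -/
structure PlaneDrawing {V : Type*} (G : SimpleGraph V) where
  point : V → ℝ × ℝ
  arc : Sym2 V → Set (ℝ × ℝ)
  point_injective : Function.Injective point
  isSimpleArc : ∀ u v : V, G.Adj u v → IsSimpleArc (point u) (point v) (arc s(u, v))
  mem_of_point_mem : ∀ e ∈ G.edgeSet, ∀ w : V, point w ∈ arc e → w ∈ e
  inter_subset : ∀ e ∈ G.edgeSet, ∀ f ∈ G.edgeSet, e ≠ f →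
    arc e ∩ arc f ⊆ point '' {w : V | w ∈ e ∧ w ∈ f}

/-- `G` can be drawn in the plane without crossings. -/
def IsPlanar {V : Type*} (G : SimpleGraph V) : Prop :=
  Nonempty (PlaneDrawing G)

/-- The class of 3-degenerate bipartite planar graphs. -/
def InClass {V : Type*} (G : SimpleGraph V) : Prop :=
  IsDegenerate G 3 ∧ G.IsBipartite ∧ IsPlanar G

open Classical in
/-- The maximum number of minimal connected dominating sets in a 3-degenerate bipartite planar
graph of order `n` (a maximum over a finite non-empty set of graphs). -/
noncomputable def maxMinimalCDS (n : ℕ) : ℕ :=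
  (Finset.univ.filter fun G : SimpleGraph (Fin n) => InClass G).sup numMinimalCDS

/-- The vertices of the base graph: the layers `X`, `Y` and `{z}`. -/
inductive BaseVertex (t : ℕ) : Type
  | x (i : Fin t)
  | y (i : Fin t)
  | z
  deriving DecidableEq, Fintype

/-- Adjacency in the base graph: `X` is a clique, `Y` is independent, `x i` is adjacent to `y j` if
and only if `i ≠ j`, and `z` is adjacent to exactly the vertices of `Y`. -/
def baseAdj {t : ℕ} : BaseVertex t → BaseVertex t → Prop
  | .x i, .x j => i ≠ j
  | .x i, .y j => i ≠ j
  | .y j, .x i => i ≠ j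
  | .y _, .z => True
  | .z, .y _ => True
  | _, _ => False

/-- The base graph `G_t` of order `2 * t + 1`. -/
def baseGraph (t : ℕ) : SimpleGraph (BaseVertex t) where
  Adj := baseAdj
  symm := ⟨by rintro (i | i | _) (j | j | _) h <;> simp_all [baseAdj, eq_comm]⟩
  loopless := ⟨by rintro (i | i | _) h <;> simp [baseAdj] at h⟩

/-- The vertices of `G_t^k`: the hub, and `k` copies of the vertices of `G_t`. -/
inductive HubVertex (t k : ℕ) : Type
  | hub
  | copy (i : Fin k) (v : BaseVertex t)
  deriving DecidableEq, Fintype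

/-- Adjacency in `G_t^k`: the hub is adjacent to the vertices of `X` in every copy of `G_t`, and
different copies are not joined. -/
def hubAdj {t k : ℕ} : HubVertex t k → HubVertex t k → Prop
  | .hub, .copy _ (.x _) => True
  | .copy _ (.x _), .hub => True
  | .copy i v, .copy j w => i = j ∧ (baseGraph t).Adj v w
  | _, _ => False

/-- The graph `G_t^k` of order `k * (2 * t + 1) + 1`. -/
def hubGraph (t k : ℕ) : SimpleGraph (HubVertex t k) where
  Adj := hubAdj
  symm := ⟨by
    rintro (_ | ⟨i, i' | i' | _⟩) (_ | ⟨j, j' | j' | _⟩) h <;>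
      simp_all [hubAdj, baseGraph, baseAdj, eq_comm]⟩
  loopless := ⟨by
    rintro (_ | ⟨i, i' | i' | _⟩) h <;> simp [hubAdj, baseGraph] at h⟩

/-- The pairs of vertices that lie in the layer `X` of the same copy of `G_t`. -/
def xEdges (t k : ℕ) : Set (Sym2 (HubVertex t k)) :=
  {e | ∃ (i : Fin k) (a b : Fin t), e = s(.copy i (.x a), .copy i (.x b))}

/-- The graph `G_t^k` without the edges inside the layers `X`. -/
def reducedHubGraph (t k : ℕ) : SimpleGraph (HubVertex t k) :=
  (hubGraph t k).deleteEdges (xEdges t k)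

end MinCDS

/-! Suppose `k ≥ 2`. The vertex `z` of a copy has all its neighbours in that copy, so a connected
dominating set meets every copy. Copies are joined only through the hub, so the hub belongs to the
set. Given the hub, domination and connectedness split into independent conditions on the traces on
the copies (`IsLocalCDS`). Hence minimal sets are families of minimal traces
(`minimal_isConnectedDominatingSet_eq_image`). For `t = 3` these are nine sets `{x a, x b, y j}`
with `a ≠ b` and six sets `{x i, y j, z}` with `i ≠ j`, which gives `15 ^ k`.

The hub and one copy form a cube graph. It is drawn with straight edges inside a narrow cone whose
apex is the hub, and shears place the copies in disjoint cones.

For the remaining orders, `r ≤ 6` pendant vertices are attached to the hub. Since the hub is in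
every connected dominating set, no minimal set is lost, and the new graph stays in the class as an
induced subgraph of `reducedHubGraph 3 (k + r)`. Finally `1.472 ^ 7 < 15`. -/

namespace MinCDS

/-! ### Connected dominating sets and graph classes under embeddings -/

section General

variable {V W : Type*}

/-- A vertex set that contains a vertex of `S` and is closed under adjacency inside `S` contains
all of `S` if `S` induces a connected graph. -/
lemma mem_of_connected_induce {G : SimpleGraph V} {S A : Set V} (hS : (G.induce S).Connected)
    {a : V} (haS : a ∈ S) (haA : a ∈ A)
    (hA : ∀ u ∈ S, u ∈ A → ∀ w ∈ S, G.Adj u w → w ∈ A) {v : V} (hv : v ∈ S) : v ∈ A := by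
  obtain ⟨p⟩ := hS.preconnected ⟨a, haS⟩ ⟨v, hv⟩
  have key : ∀ u w : S, (G.induce S).Walk u w → u.1 ∈ A → w.1 ∈ A := by
    intro u w p
    induction p with
    | nil => exact id
    | cons h _ ih => exact fun hu => ih (hA _ (Subtype.prop _) hu _ (Subtype.prop _) h)
  exact key _ _ p haA

lemma connected_induce_of_reachable {G : SimpleGraph V} {S : Set V} {a : V} (ha : a ∈ S)
    (h : ∀ v : S, (G.induce S).Reachable v ⟨a, ha⟩) : (G.induce S).Connected :=
  { preconnected := fun u v => (h u).trans (h v).symm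
    nonempty := ⟨⟨a, ha⟩⟩ }

/-- The induced graphs on `S` and `φ '' S` are isomorphic, so only domination outside the range
matters, and `φ v` provides it. -/
lemma isConnectedDominatingSet_image_iff {G : SimpleGraph V} {H : SimpleGraph W} (φ : G ↪g H)
    {v : V} (hv : ∀ S, IsConnectedDominatingSet G S → v ∈ S)
    (hφ : ∀ w, w ∉ Set.range φ → H.Adj (φ v) w) (S : Set V) :
    IsConnectedDominatingSet H (φ '' S) ↔ IsConnectedDominatingSet G S := by
  have e : G.induce S ≃g H.induce (φ '' S) :=
    { toEquiv := Equiv.Set.image φ S φ.injective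
      map_rel_iff' := φ.map_adj_iff }
  constructor
  · rintro ⟨hd, hc⟩
    refine ⟨fun u => ?_, e.connected_iff.2 hc⟩
    rcases hd (φ u) with ⟨u', hu', h⟩ | ⟨_, ⟨u', hu', rfl⟩, h⟩
    · exact Or.inl (φ.injective h ▸ hu')
    · exact Or.inr ⟨u', hu', φ.map_adj_iff.1 h⟩
  · intro hS
    refine ⟨fun w => ?_, e.connected_iff.1 hS.2⟩
    by_cases hw : w ∈ Set.range φ
    · obtain ⟨u, rfl⟩ := hw
      rcases hS.1 u with h | ⟨u', hu', h⟩
      · exact Or.inl ⟨u, h, rfl⟩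
      · exact Or.inr ⟨φ u', ⟨u', hu', rfl⟩, φ.map_adj_iff.2 h⟩
    · exact Or.inr ⟨φ v, ⟨v, hv S hS, rfl⟩, hφ w hw⟩

/-- Adding neighbours of a vertex that lies in every connected dominating set does not decrease
the number of minimal connected dominating sets. -/
lemma numMinimalCDS_le_of_embedding [Finite W] {G : SimpleGraph V} {H : SimpleGraph W}
    (φ : G ↪g H) {v : V} (hv : ∀ S, IsConnectedDominatingSet G S → v ∈ S)
    (hφ : ∀ w, w ∉ Set.range φ → H.Adj (φ v) w) : numMinimalCDS G ≤ numMinimalCDS H := by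
  refine Set.ncard_le_ncard_of_injOn (fun S => φ '' S) ?_ φ.injective.image_injective.injOn
    (Set.toFinite _)
  intro S hS
  refine ⟨(isConnectedDominatingSet_image_iff φ hv hφ S).2 hS.1, ?_⟩
  -- A subset of an image is again an image, so minimality transfers back along `φ`.
  intro T hT hTS
  obtain ⟨T', hT', rfl⟩ := Set.subset_image_iff.1 hTS
  exact Set.image_mono (hS.2 ((isConnectedDominatingSet_image_iff φ hv hφ T').1 hT) hT')

lemma IsDegenerate.of_embedding {G : SimpleGraph V} {H : SimpleGraph W} {d : ℕ}
    (hH : IsDegenerate H d) (φ : G ↪g H) : IsDegenerate G d := by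
  intro A hA
  obtain ⟨w, hw, hd⟩ := hH (A.map φ.toEmbedding) (hA.map)
  obtain ⟨v, hv, rfl⟩ := Finset.mem_map.1 hw
  refine ⟨v, hv, le_trans ?_ hd⟩
  refine Set.ncard_le_ncard_of_injOn φ ?_ φ.injective.injOn
    ((A.map φ.toEmbedding).finite_toSet.subset fun _ h => h.1)
  rintro u ⟨hu, huv⟩
  exact ⟨Finset.mem_map_of_mem φ.toEmbedding hu, φ.map_adj_iff.2 huv⟩

lemma IsPlanar.of_embedding {G : SimpleGraph V} {H : SimpleGraph W} (hH : IsPlanar H)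
    (φ : G ↪g H) : IsPlanar G := by
  obtain ⟨D⟩ := hH
  have hedge : ∀ e ∈ G.edgeSet, e.map φ ∈ H.edgeSet := by
    intro e
    induction e with
    | _ u v => exact fun h => φ.map_adj_iff.2 h
  have hmem : ∀ (e : Sym2 V) (v : V), φ v ∈ e.map φ → v ∈ e := by
    intro e v h
    obtain ⟨u, hu, h⟩ := Sym2.mem_map.1 h
    exact φ.injective h ▸ hu
  exact ⟨{
    point := D.point ∘ φ
    arc := fun e => D.arc (e.map φ)
    point_injective := D.point_injective.comp φ.injective
    isSimpleArc := fun u v h => D.isSimpleArc _ _ (φ.map_adj_iff.2 h)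
    mem_of_point_mem := fun e he w hw => hmem e w (D.mem_of_point_mem _ (hedge e he) _ hw)
    inter_subset := by
      intro e he f hf hef q hq
      obtain ⟨w, ⟨hwe, hwf⟩, rfl⟩ := D.inter_subset _ (hedge e he) _ (hedge f hf)
        (fun h => hef (Sym2.map.injective φ.injective h)) hq
      obtain ⟨u, hu, rfl⟩ := Sym2.mem_map.1 hwe
      exact ⟨u, ⟨hu, hmem f u hwf⟩, rfl⟩ }⟩

lemma InClass.of_embedding {G : SimpleGraph V} {H : SimpleGraph W} (hH : InClass H)
    (φ : G ↪g H) : InClass G :=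
  ⟨hH.1.of_embedding φ, hH.2.1.of_hom φ.toHom, hH.2.2.of_embedding φ⟩

end General

/-! ### Adjacency, bipartiteness and degeneracy of the reduced graph -/

section Adjacency

variable {t k : ℕ}

@[simp] lemma reducedHubGraph_adj_hub_hub :
    ¬ (reducedHubGraph t k).Adj .hub .hub := (reducedHubGraph t k).irrefl

@[simp] lemma reducedHubGraph_adj_hub_x (i : Fin k) (a : Fin t) :
    (reducedHubGraph t k).Adj .hub (.copy i (.x a)) := by
  simp [reducedHubGraph, hubGraph, hubAdj, xEdges]

@[simp] lemma reducedHubGraph_adj_hub_y (i : Fin k) (a : Fin t) :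
    ¬ (reducedHubGraph t k).Adj .hub (.copy i (.y a)) := by
  simp [reducedHubGraph, hubGraph, hubAdj]

@[simp] lemma reducedHubGraph_adj_hub_z (i : Fin k) :
    ¬ (reducedHubGraph t k).Adj .hub (.copy i .z) := by
  simp [reducedHubGraph, hubGraph, hubAdj]

/-- Adjacency inside a copy of the base graph after deleting the edges inside `X`. -/
def reducedBaseAdj : BaseVertex t → BaseVertex t → Prop
  | .x i, .y j => i ≠ j
  | .y j, .x i => i ≠ j
  | .y _, .z => True
  | .z, .y _ => True
  | _, _ => False

@[simp] lemma reducedHubGraph_adj_copy_copy (i j : Fin k) (v w : BaseVertex t) :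
    (reducedHubGraph t k).Adj (.copy i v) (.copy j w) ↔ i = j ∧ reducedBaseAdj v w := by
  rcases v with a | a | _ <;> rcases w with b | b | _ <;>
    simp [reducedHubGraph, hubGraph, hubAdj, xEdges, baseGraph, baseAdj, reducedBaseAdj]
  rintro rfl -
  exact ⟨i, a, b, by simp⟩

@[simp] lemma reducedHubGraph_adj_x_hub (i : Fin k) (a : Fin t) :
    (reducedHubGraph t k).Adj (.copy i (.x a)) .hub := (reducedHubGraph_adj_hub_x i a).symm

@[simp] lemma reducedHubGraph_adj_y_hub (i : Fin k) (a : Fin t) :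
    ¬ (reducedHubGraph t k).Adj (.copy i (.y a)) .hub :=
  fun h => reducedHubGraph_adj_hub_y i a h.symm

@[simp] lemma reducedHubGraph_adj_z_hub (i : Fin k) :
    ¬ (reducedHubGraph t k).Adj (.copy i .z) .hub :=
  fun h => reducedHubGraph_adj_hub_z i h.symm

lemma reducedHubGraph_isBipartite (t k : ℕ) : (reducedHubGraph t k).IsBipartite := by
  refine ⟨SimpleGraph.Coloring.mk (fun v => match v with
    | .hub => 0
    | .copy _ (.x _) => 1
    | .copy _ (.y _) => 0
    | .copy _ .z => 1) ?_⟩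
  rintro (_ | ⟨i, a | a | _⟩) (_ | ⟨j, b | b | _⟩) <;> simp [reducedBaseAdj]

lemma reducedHubGraph_isDegenerate (k : ℕ) : IsDegenerate (reducedHubGraph 3 k) 3 := by
  classical
  have bound : ∀ (A : Set (HubVertex 3 k)) (F : Finset (HubVertex 3 k)), A ⊆ F → F.card ≤ 3 →
      A.ncard ≤ 3 := fun A F h hF =>
    (Set.ncard_le_ncard h F.finite_toSet).trans ((Set.ncard_coe_finset F).trans_le hF)
  have hcard : ∀ f : Fin 3 → HubVertex 3 k, (Finset.univ.image f).card ≤ 3 := fun f =>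
    Finset.card_image_le.trans (by simp)
  intro A hA
  -- Peel off the layers in the order `z`, `Y`, `X`, hub: once the earlier layers are absent from
  -- `A`, a vertex of the current layer has neighbours only in the next one.
  by_cases hz : ∃ i, .copy i .z ∈ A
  · obtain ⟨i, hi⟩ := hz
    refine ⟨_, hi, bound _ (Finset.univ.image fun a => .copy i (.y a)) ?_ (hcard _)⟩
    rintro (_ | ⟨j, b | b | _⟩) <;> simp [reducedBaseAdj, eq_comm]
  push Not at hz
  by_cases hy : ∃ i a, .copy i (.y a) ∈ A
  · obtain ⟨i, a, hi⟩ := hy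
    refine ⟨_, hi, bound _ (Finset.univ.image fun a => .copy i (.x a)) ?_ (hcard _)⟩
    rintro (_ | ⟨j, b | b | _⟩) <;> simp [reducedBaseAdj, hz, eq_comm]
    grind
  push Not at hy
  by_cases hx : ∃ i a, .copy i (.x a) ∈ A
  · obtain ⟨i, a, hi⟩ := hx
    refine ⟨_, hi, bound _ {.hub} ?_ (by simp)⟩
    rintro (_ | ⟨j, b | b | _⟩) <;> simp [reducedBaseAdj, hy]
  push Not at hx
  obtain ⟨v, hv⟩ := hA
  refine ⟨v, hv, bound _ ∅ ?_ (by simp)⟩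
  rintro (_ | ⟨j, b | b | _⟩) <;> simp [hx, hy, hz]
  rcases v with _ | ⟨j, b | b | _⟩ <;> simp_all

end Adjacency

/-! ### Reduction to independent conditions on the copies -/

/-- The conditions that a connected dominating set of `reducedHubGraph t k` containing the hub
imposes on its trace on a copy of the base graph. -/
def IsLocalCDS {t : ℕ} (T : Set (BaseVertex t)) : Prop :=
  (∀ j, .y j ∈ T ∨ .z ∈ T ∨ ∃ i, i ≠ j ∧ .x i ∈ T) ∧
  (.z ∈ T ∨ ∃ j, .y j ∈ T) ∧
  (∀ j, .y j ∈ T → .z ∈ T ∨ ∃ i, i ≠ j ∧ .x i ∈ T) ∧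
  (.z ∈ T → ∃ j, .y j ∈ T ∧ ∃ i, i ≠ j ∧ .x i ∈ T)

section Characterization

variable {t k : ℕ}

lemma exists_mem_copy_of_isConnectedDominatingSet {S : Set (HubVertex t k)}
    (hS : IsConnectedDominatingSet (reducedHubGraph t k) S) (i : Fin k) :
    .copy i .z ∈ S ∨ ∃ j, .copy i (.y j) ∈ S := by
  rcases hS.1 (.copy i .z) with h | ⟨_ | ⟨j, a | a | _⟩, hu, h⟩
  · exact Or.inl h
  all_goals simp [reducedBaseAdj] at h
  subst h
  exact Or.inr ⟨a, hu⟩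

lemma hub_mem_of_isConnectedDominatingSet (hk : 2 ≤ k) {S : Set (HubVertex t k)}
    (hS : IsConnectedDominatingSet (reducedHubGraph t k) S) : .hub ∈ S := by
  have hne : ∀ i : Fin k, ∃ v, .copy i v ∈ S := fun i =>
    (exists_mem_copy_of_isConnectedDominatingSet hS i).elim (fun h => ⟨_, h⟩)
      fun ⟨_, h⟩ => ⟨_, h⟩
  by_contra hub
  obtain ⟨v, hv⟩ := hne ⟨0, by omega⟩
  obtain ⟨w, hw⟩ := hne ⟨1, by omega⟩
  -- Without the hub, the part of `S` in copy 0 is closed under adjacency in `S`, so it cannot reach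
  -- copy 1.
  have := mem_of_connected_induce (A := {u | ∃ v, u = .copy ⟨0, by omega⟩ v}) hS.2 hv ⟨v, rfl⟩
    ?_ hw
  · simp at this
  · rintro _ - ⟨a, rfl⟩ (_ | ⟨j, b⟩) hb h
    · exact absurd hb hub
    · simp at h
      exact ⟨b, by rw [h.1]⟩

lemma isLocalCDS_of_isConnectedDominatingSet {S : Set (HubVertex t k)}
    (hS : IsConnectedDominatingSet (reducedHubGraph t k) S) (hub : .hub ∈ S) (i : Fin k) :
    IsLocalCDS {v | .copy i v ∈ S} := by
  -- `B` lists the vertices of the copy that have a route to the hub through `S` of one of the forms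
  -- `x`, `y x`, `z y x`, `y z y x`.
  let B : Set (BaseVertex t) := {v | match v with
      | .x _ => True
      | .y j => (.copy i .z ∈ S ∧ ∃ l, .copy i (.y l) ∈ S ∧ ∃ a, a ≠ l ∧ .copy i (.x a) ∈ S) ∨
          ∃ a, a ≠ j ∧ .copy i (.x a) ∈ S
      | .z => ∃ j, .copy i (.y j) ∈ S ∧ ∃ a, a ≠ j ∧ .copy i (.x a) ∈ S}
  have hA : ∀ v, .copy i v ∈ S → v ∈ B := by
    intro v hv
    -- Membership in `A` is vacuous for the hub and for other copies, so only adjacencies ending in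
    -- copy `i` need checking.
    refine mem_of_connected_induce (A := {u | ∀ v, u = .copy i v → v ∈ B}) hS.2 hub
      (fun v h => by simp at h) ?_ hv v rfl
    rintro (_ | ⟨j, b⟩) hu hA w hw h v rfl
    · rcases v with a | a | _
      · trivial
      all_goals simp at h
    · rw [reducedHubGraph_adj_copy_copy] at h
      obtain ⟨rfl, h⟩ := h
      have hb := hA b rfl
      rcases b with b | b | _ <;> rcases v with a | a | _ <;> try exact h.elim
      · exact Or.inr ⟨b, h, hu⟩
      · trivial
      · exact hb.elim And.right fun hb => ⟨b, hu, hb⟩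
      · exact Or.inl ⟨hu, hb⟩
  refine ⟨fun j => ?_, exists_mem_copy_of_isConnectedDominatingSet hS i,
    fun j hj => (hA _ hj).imp_left And.left, fun hz => hA _ hz⟩
  rcases hS.1 (.copy i (.y j)) with h | ⟨_ | ⟨l, a | a | _⟩, hu, h⟩
  · exact Or.inl h
  all_goals simp [reducedBaseAdj] at h
  · obtain ⟨rfl, h⟩ := h
    exact Or.inr (Or.inr ⟨a, h, hu⟩)
  · subst h
    exact Or.inr (Or.inl hu)

/-- The last two local conditions give every vertex of `S` in a copy a path to the hub: `x`
directly, then `z` through some `y` and `x`, then `y` through `x` or `z`. -/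
lemma isConnectedDominatingSet_of_isLocalCDS {S : Set (HubVertex t k)}
    (hub : .hub ∈ S) (h : ∀ i, IsLocalCDS {v | .copy i v ∈ S}) :
    IsConnectedDominatingSet (reducedHubGraph t k) S := by
  refine ⟨?_, connected_induce_of_reachable hub ?_⟩
  · rintro (_ | ⟨i, a | j | _⟩)
    · exact Or.inl hub
    · exact Or.inr ⟨_, hub, by simp⟩
    · rcases (h i).1 j with h | h | ⟨a, ha, h⟩
      · exact Or.inl h
      · exact Or.inr ⟨_, h, by simp [reducedBaseAdj]⟩
      · exact Or.inr ⟨_, h, by simpa [reducedBaseAdj] using ha⟩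
    · rcases (h i).2.1 with h | ⟨j, h⟩
      · exact Or.inl h
      · exact Or.inr ⟨_, h, by simp [reducedBaseAdj]⟩
  · have step : ∀ {u v : HubVertex t k} (hu : u ∈ S) (hv : v ∈ S),
        (reducedHubGraph t k).Adj u v →
        ((reducedHubGraph t k).induce S).Reachable ⟨v, hv⟩ ⟨.hub, hub⟩ →
        ((reducedHubGraph t k).induce S).Reachable ⟨u, hu⟩ ⟨.hub, hub⟩ := fun hu hv huv hr =>
      (SimpleGraph.Adj.reachable (G := (reducedHubGraph t k).induce S)
        (u := ⟨_, hu⟩) (v := ⟨_, hv⟩) huv).trans hr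
    have hx : ∀ i a (h : .copy i (.x a) ∈ S),
        ((reducedHubGraph t k).induce S).Reachable ⟨_, h⟩ ⟨.hub, hub⟩ := fun i a h =>
      step h hub (by simp) (SimpleGraph.Reachable.refl _)
    have hz : ∀ i (h : .copy i .z ∈ S),
        ((reducedHubGraph t k).induce S).Reachable ⟨_, h⟩ ⟨.hub, hub⟩ := by
      intro i hz
      obtain ⟨j, hj, a, ha, hxa⟩ := (h i).2.2.2 hz
      exact step hz hj (by simp [reducedBaseAdj])
        (step hj hxa (by simpa [reducedBaseAdj] using ha) (hx i a hxa))
    rintro ⟨_ | ⟨i, a | j | _⟩, hv⟩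
    · exact SimpleGraph.Reachable.refl _
    · exact hx i a hv
    · rcases (h i).2.2.1 j hv with hz' | ⟨a, ha, hxa⟩
      · exact step hv hz' (by simp [reducedBaseAdj]) (hz i hz')
      · exact step hv hxa (by simpa [reducedBaseAdj] using ha) (hx i a hxa)
    · exact hz i hv

end Characterization

/-! ### Counting minimal sets -/

/-- The vertex set consisting of the hub and the set `T i` in the `i`-th copy. -/
def hubSet {t k : ℕ} (T : Fin k → Set (BaseVertex t)) : Set (HubVertex t k) :=
  {v | match v with
    | .hub => True
    | .copy i v => v ∈ T i}

section Counting

variable {t k : ℕ}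

lemma hubSet_subset_hubSet_iff {T U : Fin k → Set (BaseVertex t)} :
    hubSet T ⊆ hubSet U ↔ T ≤ U :=
  ⟨fun h i v hv => @h (.copy i v) hv, fun h v hv => match v, hv with
    | .hub, _ => trivial
    | .copy i _, hv => h i hv⟩

lemma hubSet_injective : Function.Injective (hubSet (t := t) (k := k)) := fun _ _ h =>
  le_antisymm (hubSet_subset_hubSet_iff.1 h.le) (hubSet_subset_hubSet_iff.1 h.ge)

lemma isConnectedDominatingSet_iff (hk : 2 ≤ k) (S : Set (HubVertex t k)) :
    IsConnectedDominatingSet (reducedHubGraph t k) S ↔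
      ∃ T : Fin k → Set (BaseVertex t), (∀ i, IsLocalCDS (T i)) ∧ hubSet T = S := by
  constructor
  · intro hS
    have hub := hub_mem_of_isConnectedDominatingSet hk hS
    refine ⟨fun i => {v | .copy i v ∈ S}, isLocalCDS_of_isConnectedDominatingSet hS hub, ?_⟩
    ext (_ | ⟨i, v⟩)
    · exact iff_of_true trivial hub
    · rfl
  · rintro ⟨T, hT, rfl⟩
    exact isConnectedDominatingSet_of_isLocalCDS trivial hT

lemma minimal_isConnectedDominatingSet_eq_image (hk : 2 ≤ k) :
    {S | Minimal (IsConnectedDominatingSet (reducedHubGraph t k)) S} =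
      hubSet '' {T | ∀ i, Minimal IsLocalCDS (T i)} := by
  ext S
  constructor
  · rintro ⟨hS, hmin⟩
    obtain ⟨T, hT, rfl⟩ := (isConnectedDominatingSet_iff hk S).1 hS
    refine ⟨T, fun i => ⟨hT i, fun U hU hUT => ?_⟩, rfl⟩
    -- Shrinking the trace on a single copy keeps a connected dominating set, so minimality holds in
    -- each coordinate.
    have := hubSet_subset_hubSet_iff.1 (hmin (y := hubSet (Function.update T i U))
      ((isConnectedDominatingSet_iff hk _).2 ⟨_, fun j => ?_, rfl⟩)
      (hubSet_subset_hubSet_iff.2 (update_le_self_iff.2 hUT))) i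
    · simpa using this
    · rcases eq_or_ne j i with rfl | h
      · simpa using hU
      · simpa [h] using hT j
  · rintro ⟨T, hT, rfl⟩
    refine ⟨(isConnectedDominatingSet_iff hk _).2 ⟨T, fun i => (hT i).1, rfl⟩, ?_⟩
    intro S hS hST
    obtain ⟨U, hU, rfl⟩ := (isConnectedDominatingSet_iff hk S).1 hS
    exact hubSet_subset_hubSet_iff.2 fun i =>
      (hT i).2 (hU i) (hubSet_subset_hubSet_iff.1 hST i)

lemma numMinimalCDS_reducedHubGraph (hk : 2 ≤ k) :
    numMinimalCDS (reducedHubGraph t k) =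
      {T : Set (BaseVertex t) | Minimal IsLocalCDS T}.ncard ^ k := by
  rw [numMinimalCDS, minimal_isConnectedDominatingSet_eq_image hk,
    Set.ncard_image_of_injective _ hubSet_injective, ← Nat.card_coe_set_eq,
    ← Nat.card_coe_set_eq]
  have e : {T : Fin k → Set (BaseVertex t) | ∀ i, Minimal IsLocalCDS (T i)} ≃
      (Fin k → {T : Set (BaseVertex t) | Minimal IsLocalCDS T}) :=
    Equiv.subtypePiEquivPi
  rw [Nat.card_congr e, Nat.card_fun, Nat.card_fin]

end Counting

instance (F : Finset (BaseVertex 3)) : Decidable (IsLocalCDS (F : Set (BaseVertex 3))) := by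
  unfold IsLocalCDS
  simp only [Finset.mem_coe]
  infer_instance

/-- If `z` is absent, at least two `x`s are needed: with only `x a`, the vertex `y a` is neither
dominated nor connected. Any two `x`s and any `y` then suffice. If `z` is present, some `y j` and `x
i` with `i ≠ j` are needed and suffice. The proof evaluates the count over finite sets. -/
lemma ncard_minimal_isLocalCDS :
    {T : Set (BaseVertex 3) | Minimal IsLocalCDS T}.ncard = 15 := by
  have key : {T : Set (BaseVertex 3) | Minimal IsLocalCDS T} =
      (fun F : Finset (BaseVertex 3) => (F : Set (BaseVertex 3))) ''
        (Finset.univ.filter fun F : Finset (BaseVertex 3) => IsLocalCDS (F : Set (BaseVertex 3)) ∧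
          ∀ F' : Finset (BaseVertex 3), F' ∈ F.powerset → IsLocalCDS (F' : Set (BaseVertex 3)) →
            F ⊆ F' : Finset (Finset (BaseVertex 3))) := by
    ext T
    obtain ⟨F, rfl⟩ := T.toFinite.exists_finset_coe
    rw [Finset.coe_injective.mem_set_image]
    simp only [Finset.mem_powerset, Finset.coe_filter, Finset.mem_univ, true_and,
      Set.mem_ofPred_eq]
    refine and_congr_right fun _ => ⟨fun h F' hF' hL => ?_, fun h U hU hUF => ?_⟩
    · exact Finset.coe_subset.1 (h hL (Finset.coe_subset.2 hF'))
    · obtain ⟨F', rfl⟩ := U.toFinite.exists_finset_coe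
      exact Finset.coe_subset.2 (h F' (Finset.coe_subset.1 hUF) hU)
  rw [key, Set.ncard_image_of_injective _ Finset.coe_injective, Set.ncard_coe_finset]
  decide +kernel

/-! ### Planarity by a straight-line drawing -/

lemma isSimpleArc_segment {p q : ℝ × ℝ} (h : p ≠ q) : IsSimpleArc p q (segment ℝ p q) := by
  refine ⟨fun t => AffineMap.lineMap p q (t : ℝ), ?_, ?_, by simp, by simp, ?_⟩
  · exact AffineMap.lineMap_continuous.comp continuous_subtype_val
  · exact (AffineMap.lineMap_injective ℝ h).comp Subtype.val_injective
  · rw [segment_eq_image_lineMap]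
    exact (Set.image_eq_range _ _).symm

/-- A straight-line drawing without crossings. -/
lemma isPlanar_of_segment {V : Type*} {G : SimpleGraph V} (p : V → ℝ × ℝ)
    (hp : Function.Injective p)
    (hmem : ∀ u v, G.Adj u v → ∀ w, p w ∈ segment ℝ (p u) (p v) → w = u ∨ w = v)
    (hinter : ∀ u v, G.Adj u v → ∀ u' v', G.Adj u' v' → s(u, v) ≠ s(u', v') →
      ∀ q ∈ segment ℝ (p u) (p v), q ∈ segment ℝ (p u') (p v') → ∃ w, q = p w) :
    IsPlanar G := by
  have hmem' : ∀ u v, G.Adj u v → ∀ w, p w ∈ segment ℝ (p u) (p v) → w ∈ s(u, v) :=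
    fun u v h w hw => Sym2.mem_iff.2 (hmem u v h w hw)
  refine ⟨{
    point := p
    arc := Sym2.lift ⟨fun u v => segment ℝ (p u) (p v), fun u v => segment_symm ℝ _ _⟩
    point_injective := hp
    isSimpleArc := fun u v h => isSimpleArc_segment (hp.ne h.ne)
    mem_of_point_mem := ?_
    inter_subset := ?_ }⟩
  · rintro ⟨u, v⟩ he w hw
    exact hmem' u v he w hw
  · rintro ⟨u, v⟩ he ⟨u', v'⟩ hf hne q ⟨hq, hq'⟩
    obtain ⟨w, rfl⟩ := hinter u v he u' v' hf hne q hq hq'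
    exact ⟨w, ⟨hmem' u v he w hq, hmem' u' v' hf w hq'⟩, rfl⟩

/-- Twice the signed area of the triangle `a b c`. -/
def orient {R : Type*} [CommRing R] (a b c : R × R) : R :=
  (b.1 - a.1) * (c.2 - a.2) - (b.2 - a.2) * (c.1 - a.1)

lemma orient_combo {R : Type*} [CommRing R] (a b c d : R × R) {r s : R} (h : r + s = 1) :
    orient a b (r • c + s • d) = r * orient a b c + s * orient a b d := by
  obtain rfl : r = 1 - s := eq_sub_of_add_eq h
  simp only [orient, Prod.fst_add, Prod.snd_add, Prod.smul_fst, Prod.smul_snd, smul_eq_mul]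
  ring

lemma orient_eq_zero_of_mem_segment {a b q : ℝ × ℝ} (h : q ∈ segment ℝ a b) :
    orient a b q = 0 := by
  obtain ⟨r, s, -, -, hrs, rfl⟩ := h
  rw [orient_combo a b a b hrs]
  simp only [orient]
  ring

/-- If the line `a b` does not separate `c` from `d`, and does not contain both of them, then the
segments `a b` and `c d` can only meet in `c` or `d`. -/
lemma eq_or_eq_of_mem_segment {a b c d q : ℝ × ℝ} (hq : q ∈ segment ℝ a b)
    (hq' : q ∈ segment ℝ c d) (h : 0 ≤ orient a b c * orient a b d)
    (h0 : orient a b c ≠ 0 ∨ orient a b d ≠ 0) : q = c ∨ q = d := by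
  have hz := orient_eq_zero_of_mem_segment hq
  obtain ⟨r, s, hr, hs, hrs, rfl⟩ := hq'
  rw [orient_combo a b c d hrs] at hz
  generalize orient a b c = A at *
  generalize orient a b d = B at *
  -- Multiplying `r * A + s * B = 0` by `A` gives a vanishing sum of two nonnegative terms.
  have h1 : r * A ^ 2 = 0 := by
    nlinarith [mul_nonneg hr (sq_nonneg A), mul_nonneg hs h, congrArg (· * A) hz]
  have h2 : s * B ^ 2 = 0 := by
    nlinarith [mul_nonneg hs (sq_nonneg B), mul_nonneg hr h, congrArg (· * B) hz]
  rcases h0 with h0 | h0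
  · have : r = 0 := by simpa [h0] using h1
    subst this
    have : s = 1 := by linarith
    simp [this]
  · have : s = 0 := by simpa [h0] using h2
    subst this
    have : r = 1 := by linarith
    simp [this]

/-- The positions of the hub (`none`) and of the vertices of one copy in a straight-line drawing
of the cube graph. -/
def cubePos : Option (BaseVertex 3) → ℤ × ℤ
  | none => (0, 0)
  | some (.x 0) => (5, 4)
  | some (.x 1) => (6, -5)
  | some (.x 2) => (3, 1)
  | some (.y 0) => (4, -3)
  | some (.y 1) => (6, 3)
  | some (.y 2) => (12, 1)
  | some .z => (9, -1)

/-- Adjacency in the cube graph formed by the hub (`none`) and one copy. -/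
def cubeAdj : Option (BaseVertex 3) → Option (BaseVertex 3) → Bool
  | none, some (.x _) => true
  | some (.x _), none => true
  | some (.x i), some (.y j) => i ≠ j
  | some (.y j), some (.x i) => i ≠ j
  | some (.y _), some .z => true
  | some .z, some (.y _) => true
  | _, _ => false

lemma cubePos_injective : Function.Injective cubePos := by
  unfold Function.Injective
  decide +kernel

lemma cubePos_cone : ∀ v, |(cubePos (some v)).2| < (cubePos (some v)).1 := by
  decide +kernel

lemma orient_cubePos_ne_zero : ∀ a b, cubeAdj a b → ∀ c, c ≠ a → c ≠ b →
    orient (cubePos a) (cubePos b) (cubePos c) ≠ 0 := by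
  unfold orient
  decide +kernel

/-- The integer form of the hypotheses of `eq_or_eq_of_mem_segment`: for any two distinct edges, the
line through one of them does not cross the other. -/
lemma cubePos_separated : ∀ a b, cubeAdj a b → ∀ c d, cubeAdj c d → s(a, b) ≠ s(c, d) →
    (0 ≤ orient (cubePos a) (cubePos b) (cubePos c) * orient (cubePos a) (cubePos b) (cubePos d) ∧
      (orient (cubePos a) (cubePos b) (cubePos c) ≠ 0 ∨
        orient (cubePos a) (cubePos b) (cubePos d) ≠ 0)) ∨
    (0 ≤ orient (cubePos c) (cubePos d) (cubePos a) * orient (cubePos c) (cubePos d) (cubePos b) ∧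
      (orient (cubePos c) (cubePos d) (cubePos a) ≠ 0 ∨
        orient (cubePos c) (cubePos d) (cubePos b) ≠ 0)) := by
  unfold orient
  decide +kernel

/-- The inclusion of a cube into `reducedHubGraph 3 k`. -/
def cubeVertex {k : ℕ} (i : Fin k) : Option (BaseVertex 3) → HubVertex 3 k
  | none => .hub
  | some v => .copy i v

lemma exists_cubeVertex_of_adj {k : ℕ} {u v : HubVertex 3 k}
    (h : (reducedHubGraph 3 k).Adj u v) :
    ∃ i a b, cubeAdj a b ∧ u = cubeVertex i a ∧ v = cubeVertex i b := by
  rcases u with _ | ⟨i, u⟩ <;> rcases v with _ | ⟨j, v⟩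
  · simp at h
  · refine ⟨j, none, some v, ?_, rfl, rfl⟩
    rcases v with a | a | _ <;> simp [cubeAdj] at h ⊢
  · refine ⟨i, some u, none, ?_, rfl, rfl⟩
    rcases u with a | a | _ <;> simp [cubeAdj] at h ⊢
  · obtain ⟨rfl, h⟩ := (reducedHubGraph_adj_copy_copy _ _ _ _).1 h
    refine ⟨i, some u, some v, ?_, rfl, rfl⟩
    rcases u with a | a | _ <;> rcases v with b | b | _ <;>
      simp_all [cubeAdj, reducedBaseAdj]

/-- The linear shear that moves the cone of one copy to that of the `n`-th copy. -/
def shear (n : ℕ) : ℝ × ℝ →ₗ[ℝ] ℝ × ℝ where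
  toFun p := (p.1, p.2 + 2 * n * p.1)
  map_add' p q := by ext <;> simp; ring
  map_smul' c p := by ext <;> simp; ring

lemma shear_injective (n : ℕ) : Function.Injective (shear n) := by
  rintro ⟨a, b⟩ ⟨c, d⟩ h
  simp only [shear, LinearMap.coe_mk, AddHom.coe_mk, Prod.mk.injEq] at h ⊢
  obtain ⟨rfl, h⟩ := h
  exact ⟨rfl, by linarith⟩

/-- The position of a vertex of the cube in the real plane. -/
def cubePoint (v : Option (BaseVertex 3)) : ℝ × ℝ := ((cubePos v).1, (cubePos v).2)

/-- The position of a vertex of `reducedHubGraph 3 k` in the plane. -/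
def hubPoint {k : ℕ} : HubVertex 3 k → ℝ × ℝ
  | .hub => 0
  | .copy i v => shear i (cubePoint (some v))

lemma cubePoint_none : cubePoint none = 0 := by simp [cubePoint, cubePos]

lemma hubPoint_cubeVertex {k : ℕ} (i : Fin k) (a : Option (BaseVertex 3)) :
    hubPoint (cubeVertex i a) = shear i (cubePoint a) := by
  cases a with
  | none => rw [cubePoint_none, map_zero]; rfl
  | some v => rfl

lemma orient_cubePoint (a b c : Option (BaseVertex 3)) :
    orient (cubePoint a) (cubePoint b) (cubePoint c) =
      (orient (cubePos a) (cubePos b) (cubePos c) : ℤ) := by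
  simp [orient, cubePoint]

lemma cubePoint_injective : Function.Injective cubePoint := fun a b h =>
  cubePos_injective (by simpa [cubePoint, Prod.ext_iff] using h)

/-- An open cone together with its apex `0`. -/
def cone : Set (ℝ × ℝ) := {p | p = 0 ∨ |p.2| < p.1}

lemma convex_cone : Convex ℝ cone := by
  rw [convex_iff_forall_pos]
  rintro ⟨a, b⟩ hp ⟨c, d⟩ hq r s hr hs -
  simp only [cone, Set.mem_ofPred_eq, Prod.mk_eq_zero, abs_lt, Prod.smul_mk, Prod.mk_add_mk,
    smul_eq_mul] at *
  rcases hp with ⟨rfl, rfl⟩ | ⟨h1, h2⟩ <;> rcases hq with ⟨rfl, rfl⟩ | ⟨h3, h4⟩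
  · left; simp
  all_goals right; constructor <;> nlinarith

lemma cubePoint_some_cone (v : BaseVertex 3) :
    |(cubePoint (some v)).2| < (cubePoint (some v)).1 := by
  simp only [cubePoint]
  exact_mod_cast cubePos_cone v

lemma cubePoint_mem_cone (a : Option (BaseVertex 3)) : cubePoint a ∈ cone := by
  cases a with
  | none => exact Or.inl cubePoint_none
  | some v => exact Or.inr (cubePoint_some_cone v)

/-- `shear n` adds `2 * n` to slopes, so slopes in `(-1, 1)` go to `(2 * n - 1, 2 * n + 1)`, and
these intervals are disjoint for different `n`. -/
lemma eq_of_shear_eq {p q : ℝ × ℝ} {m n : ℕ} (hp : |p.2| < p.1) (hq : |q.2| < q.1)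
    (h : shear m p = shear n q) : m = n := by
  obtain ⟨a, b⟩ := p
  obtain ⟨c, d⟩ := q
  simp only [shear, LinearMap.coe_mk, AddHom.coe_mk, Prod.mk.injEq, abs_lt] at h hp hq
  obtain ⟨rfl, h⟩ := h
  have ha : 0 < a := by linarith
  by_contra hne
  rcases Nat.lt_or_gt_of_ne hne with hlt | hlt
  · have : (m : ℝ) + 1 ≤ n := by exact_mod_cast hlt
    nlinarith
  · have : (n : ℝ) + 1 ≤ m := by exact_mod_cast hlt
    nlinarith

lemma shear_mem_inter {p q : ℝ × ℝ} {m n : ℕ} (hp : p ∈ cone) (hq : q ∈ cone)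
    (h : shear m p = shear n q) : p = 0 ∨ m = n := by
  rcases hp with hp | hp
  · exact Or.inl hp
  rcases hq with rfl | hq
  · exact Or.inl (shear_injective m (by rw [h, map_zero, map_zero]))
  · exact Or.inr (eq_of_shear_eq hp hq h)

lemma mem_segment_hubPoint {k : ℕ} {i : Fin k} {a b : Option (BaseVertex 3)} {q : ℝ × ℝ}
    (h : q ∈ segment ℝ (hubPoint (cubeVertex i a)) (hubPoint (cubeVertex i b))) :
    ∃ p ∈ segment ℝ (cubePoint a) (cubePoint b), p ∈ cone ∧ q = shear i p := by
  rw [hubPoint_cubeVertex, hubPoint_cubeVertex] at h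
  replace h := (image_segment ℝ (shear i).toAffineMap _ _).ge h
  obtain ⟨p, hp, rfl⟩ := h
  exact ⟨p, hp, convex_cone.segment_subset (cubePoint_mem_cone a) (cubePoint_mem_cone b) hp, rfl⟩

lemma cubePoint_mem_segment {a b c : Option (BaseVertex 3)} (hab : cubeAdj a b)
    (h : cubePoint c ∈ segment ℝ (cubePoint a) (cubePoint b)) : c = a ∨ c = b := by
  by_contra! hc
  have := orient_eq_zero_of_mem_segment h
  rw [orient_cubePoint] at this
  exact orient_cubePos_ne_zero a b hab c hc.1 hc.2 (by exact_mod_cast this)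

lemma exists_cubePoint_of_mem_segment {a b c d : Option (BaseVertex 3)} (hab : cubeAdj a b)
    (hcd : cubeAdj c d) (hne : s(a, b) ≠ s(c, d)) {q : ℝ × ℝ}
    (hq : q ∈ segment ℝ (cubePoint a) (cubePoint b))
    (hq' : q ∈ segment ℝ (cubePoint c) (cubePoint d)) : ∃ v, q = cubePoint v := by
  rcases cubePos_separated a b hab c d hcd hne with ⟨h, h0⟩ | ⟨h, h0⟩
  · refine (eq_or_eq_of_mem_segment hq hq' ?_ ?_).elim (fun h => ⟨_, h⟩) fun h => ⟨_, h⟩ <;>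
      simp only [orient_cubePoint]
    · exact_mod_cast h
    · exact_mod_cast h0
  · refine (eq_or_eq_of_mem_segment hq' hq ?_ ?_).elim (fun h => ⟨_, h⟩) fun h => ⟨_, h⟩ <;>
      simp only [orient_cubePoint]
    · exact_mod_cast h
    · exact_mod_cast h0

lemma hubPoint_injective {k : ℕ} : Function.Injective (hubPoint (k := k)) := by
  have h0 : ∀ (i : Fin k) v, shear i (cubePoint (some v)) ≠ 0 := by
    intro i v h
    have := cubePoint_injective (a₁ := some v) (a₂ := none)
      (shear_injective i (by rw [h, cubePoint_none, map_zero]))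
    simp at this
  rintro (_ | ⟨i, v⟩) (_ | ⟨j, w⟩) h
  · rfl
  · exact absurd h.symm (h0 j w)
  · exact absurd h (h0 i v)
  · obtain rfl := Fin.ext (eq_of_shear_eq (cubePoint_some_cone v) (cubePoint_some_cone w) h)
    rw [Option.some_injective _ (cubePoint_injective (shear_injective i h))]

lemma reducedHubGraph_isPlanar (k : ℕ) : IsPlanar (reducedHubGraph 3 k) := by
  refine isPlanar_of_segment hubPoint hubPoint_injective ?_ ?_
  · intro u v huv w hw
    obtain ⟨i, a, b, hab, rfl, rfl⟩ := exists_cubeVertex_of_adj huv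
    obtain ⟨p, hp, hc, h⟩ := mem_segment_hubPoint hw
    -- The segment lies in the cone of copy `i`, which contains no vertex of another copy.
    have key : ∃ c, w = cubeVertex i c := by
      cases w with
      | hub => exact ⟨none, rfl⟩
      | copy j x =>
        rcases shear_mem_inter (cubePoint_mem_cone (some x)) hc h with h' | h'
        · simpa [h'] using cubePoint_some_cone x
        · exact ⟨some x, by rw [Fin.ext h']; rfl⟩
    obtain ⟨c, rfl⟩ := key
    rw [hubPoint_cubeVertex] at h
    obtain rfl := shear_injective i h
    exact (cubePoint_mem_segment hab hp).imp (congrArg _) (congrArg _)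
  · intro u v huv u' v' huv' hne q hq hq'
    obtain ⟨i, a, b, hab, rfl, rfl⟩ := exists_cubeVertex_of_adj huv
    obtain ⟨j, c, d, hcd, rfl, rfl⟩ := exists_cubeVertex_of_adj huv'
    obtain ⟨p, hp, hpc, rfl⟩ := mem_segment_hubPoint hq
    obtain ⟨p', hp', hpc', h⟩ := mem_segment_hubPoint hq'
    -- Cones of different copies meet only in the apex, which is the hub.
    rcases shear_mem_inter hpc hpc' h with rfl | hij
    · exact ⟨.hub, by simp [hubPoint]⟩
    · obtain rfl := Fin.ext hij
      obtain rfl := shear_injective i h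
      obtain ⟨w, rfl⟩ := exists_cubePoint_of_mem_segment hab hcd
        (fun h => hne (by simpa using congrArg (Sym2.map (cubeVertex i)) h)) hp hp'
      exact ⟨cubeVertex i w, (hubPoint_cubeVertex i w).symm⟩

lemma reducedHubGraph_inClass (k : ℕ) : InClass (reducedHubGraph 3 k) :=
  ⟨reducedHubGraph_isDegenerate k, reducedHubGraph_isBipartite 3 k, reducedHubGraph_isPlanar k⟩

/-! ### Orders, pendant vertices and the asymptotic bound -/

/-- A model of the vertex type of `hubGraph t k` by standard types. -/
def hubVertexEquiv (t k : ℕ) : HubVertex t k ≃ Option (Fin k × Option (Fin t ⊕ Fin t)) where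
  toFun
    | .hub => none
    | .copy i (.x a) => some (i, some (.inl a))
    | .copy i (.y a) => some (i, some (.inr a))
    | .copy i .z => some (i, none)
  invFun
    | none => .hub
    | some (i, some (.inl a)) => .copy i (.x a)
    | some (i, some (.inr a)) => .copy i (.y a)
    | some (i, none) => .copy i .z
  left_inv := by rintro (_ | ⟨i, a | a | _⟩) <;> rfl
  right_inv := by rintro (_ | ⟨i, _ | a | a⟩) <;> rfl

lemma card_hubVertex (t k : ℕ) : Nat.card (HubVertex t k) = (2 * t + 1) * k + 1 := by
  rw [Nat.card_congr (hubVertexEquiv t k)]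
  simp
  ring

/-- The vertices of `reducedHubGraph 3 (k + r)` in the first `k` copies, the hub, and one neighbour
of the hub in each of the last `r` copies. -/
def pendantInclusion (k r : ℕ) : HubVertex 3 k ⊕ Fin r → HubVertex 3 (k + r)
  | .inl .hub => .hub
  | .inl (.copy i v) => .copy (i.castAdd r) v
  | .inr j => .copy (j.natAdd k) (.x 0)

lemma pendantInclusion_injective (k r : ℕ) : Function.Injective (pendantInclusion k r) := by
  rintro ((_ | ⟨i, v⟩) | i) ((_ | ⟨j, w⟩) | j) h <;>
    simp [pendantInclusion, Fin.ext_iff] at h ⊢ <;> grind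

lemma pow_le_maxMinimalCDS {k : ℕ} (hk : 2 ≤ k) (r : ℕ) :
    15 ^ k ≤ maxMinimalCDS (7 * k + 1 + r) := by
  classical
  have e : Fin (7 * k + 1 + r) ≃ HubVertex 3 k ⊕ Fin r :=
    (Finite.equivFinOfCardEq (by
      rw [Nat.card_sum, card_hubVertex, Nat.card_fin])).symm
  -- `G` is `reducedHubGraph 3 k` with `r` pendant vertices at the hub. As a pullback along an
  -- injection into `reducedHubGraph 3 (k + r)`, it inherits membership in the class.
  let G : SimpleGraph (Fin (7 * k + 1 + r)) :=
    (reducedHubGraph 3 (k + r)).comap (pendantInclusion k r ∘ e)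
  let ψ : G ↪g reducedHubGraph 3 (k + r) :=
    SimpleGraph.Embedding.comap ⟨_, (pendantInclusion_injective k r).comp e.injective⟩ _
  let φ : reducedHubGraph 3 k ↪g G :=
    { toFun := fun v => e.symm (.inl v)
      inj' := e.symm.injective.comp Sum.inl_injective
      map_rel_iff' := by
        rintro (_ | ⟨i, a | a | _⟩) (_ | ⟨j, b | b | _⟩) <;>
          simp [G, pendantInclusion, reducedBaseAdj] }
  have hle : numMinimalCDS (reducedHubGraph 3 k) ≤ numMinimalCDS G := by
    refine numMinimalCDS_le_of_embedding φ (v := .hub)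
      (fun S hS => hub_mem_of_isConnectedDominatingSet hk hS) ?_
    intro w hw
    obtain ⟨v, rfl⟩ := e.symm.surjective w
    rcases v with v | j
    · exact absurd ⟨v, rfl⟩ hw
    · simp [G, φ, pendantInclusion]
  rw [numMinimalCDS_reducedHubGraph hk, ncard_minimal_isLocalCDS] at hle
  exact hle.trans (Finset.le_sup (f := numMinimalCDS)
    (Finset.mem_filter.2 ⟨Finset.mem_univ G, (reducedHubGraph_inClass (k + r)).of_embedding ψ⟩))

lemma isBigO_maxMinimalCDS : (fun n : ℕ => (1.472 : ℝ) ^ n) =O[Filter.atTop]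
    fun n : ℕ => (maxMinimalCDS n : ℝ) := by
  -- The constant 15 pays for rounding the exponent up to `7 * (k + 1)`; the threshold 15 guarantees
  -- `k ≥ 2`.
  refine Asymptotics.IsBigO.of_bound 15 (Filter.eventually_atTop.2 ⟨15, fun n hn => ?_⟩)
  obtain ⟨k, r, hk, hr, rfl⟩ : ∃ k r, 2 ≤ k ∧ r ≤ 6 ∧ n = 7 * k + 1 + r :=
    ⟨(n - 1) / 7, (n - 1) % 7, by omega, by omega, by omega⟩
  have h15 : (1.472 : ℝ) ^ 7 ≤ 15 := by norm_num
  rw [Real.norm_of_nonneg (by positivity), Real.norm_of_nonneg (by positivity)]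
  calc (1.472 : ℝ) ^ (7 * k + 1 + r) ≤ 1.472 ^ (7 * (k + 1)) :=
        pow_le_pow_right₀ (by norm_num) (by omega)
    _ = (1.472 ^ 7) ^ (k + 1) := pow_mul _ _ _
    _ ≤ 15 ^ (k + 1) := pow_le_pow_left₀ (by positivity) h15 _
    _ = 15 * 15 ^ k := pow_succ' _ _
    _ ≤ 15 * (maxMinimalCDS (7 * k + 1 + r) : ℝ) := by
        gcongr
        exact_mod_cast pow_le_maxMinimalCDS hk r

end MinCDS

theorem mainTheorem3 :
    ((fun n : ℕ => (1.472 : ℝ) ^ n) =O[Filter.atTop]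
      fun n : ℕ => (MinCDS.maxMinimalCDS n : ℝ)) ∧
    (∀ k : ℕ, 1 ≤ k →
      Nat.card (MinCDS.HubVertex 3 k) = 7 * k + 1 ∧
      (MinCDS.reducedHubGraph 3 k).IsBipartite ∧
      MinCDS.IsDegenerate (MinCDS.reducedHubGraph 3 k) 3 ∧
      MinCDS.IsPlanar (MinCDS.reducedHubGraph 3 k)) ∧
    (∀ k : ℕ, 2 ≤ k → MinCDS.numMinimalCDS (MinCDS.reducedHubGraph 3 k) = 15 ^ k) :=
  ⟨MinCDS.isBigO_maxMinimalCDS,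
    fun k _ => ⟨MinCDS.card_hubVertex 3 k, MinCDS.reducedHubGraph_isBipartite 3 k,
      MinCDS.reducedHubGraph_isDegenerate k, MinCDS.reducedHubGraph_isPlanar k⟩,
    fun _ hk => by
      rw [MinCDS.numMinimalCDS_reducedHubGraph hk, MinCDS.ncard_minimal_isLocalCDS]⟩
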